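/- Let $U$ be any unitary operator on $\mathbb{C}^2\otimes\mathbb{C}^2$, the state space of a system qubit $S$ (first factor) and an environment qubit $E$ (second factor), and let $\rho$ be any two-qubit density operator (positive semidefinite, of trace $1$) on $\mathbb{C}^2\otimes\mathbb{C}^2$. Then there are local unitaries $V$ on the system qubit and $W$ on the environment qubit such that, for the locally transformed state $$\rho' = (V\otimes W)\,\rho\,(V\otimes W)^\dagger ,$$ the dynamics of the system under $U$ can be $U$-generated from a product state; that is, there is a density operator $\zeta$ of the environment qubit with $$\operatorname{tr}_E\big(U\rho' U^\dagger\big)=\operatorname{tr}_E\big(U\,(\operatorname{tr}_E(\rho')\otimes\zeta)\,U^\dagger\big).$$ -/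

import Mathlib

open scoped Matrix Kronecker ComplexOrder

/-- A density operator (quantum state), in matrix form: positive semidefinite with unit trace. -/
def IsDensity {n : Type*} [Fintype n] (ρ : Matrix n n ℂ) : Prop :=
  ρ.PosSemidef ∧ ρ.trace = 1

/-- The partial trace over the environment (the second tensor factor). -/
def traceE {s e : Type*} [Fintype e] (M : Matrix (s × e) (s × e) ℂ) : Matrix s s ℂ :=
  fun i j => ∑ k : e, M (i, k) (j, k)

/-- The system dynamics from `traceE ρ` to `traceE (U * ρ * Uᴴ)` can be `U`-generated by a product
state: there is a density operator `ζ` of the environment such that the initial product state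
`traceE ρ ⊗ ζ` leads, under `U`, to the same final state of the system as `ρ` does. -/
def CanBeUGeneratedByProduct {s e : Type*} [Fintype s] [Fintype e]
    (U ρ : Matrix (s × e) (s × e) ℂ) : Prop :=
  ∃ ζ : Matrix e e ℂ, IsDensity ζ ∧
    traceE (U * ρ * Uᴴ) = traceE (U * (traceE ρ ⊗ₖ ζ) * Uᴴ)

/-- The state obtained from `ρ` by applying `V` to the system and `W` to the environment. -/
def applyLocal {s e : Type*} [Fintype s] [Fintype e]
    (V : Matrix s s ℂ) (W : Matrix e e ℂ) (ρ : Matrix (s × e) (s × e) ℂ) :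
    Matrix (s × e) (s × e) ℂ :=
  (V ⊗ₖ W) * ρ * (V ⊗ₖ W)ᴴ

/-!
The environment state `ζ` is the marginal `traceS ρ'` of the locally transformed state, so what has
to be shown is that the correlation part `C = ρ' - traceE ρ' ⊗ traceS ρ'` is annihilated by
`X ↦ traceE (U * X * Uᴴ)` for a suitable choice of `V` and `W`.

The tool is the spin flip, a linear anti-automorphism of the two-qubit operators which fixes `1` and
the products `σ_i ⊗ σ_j` of Pauli matrices and negates the local generators `σ_i ⊗ 1` and `1 ⊗ σ_j`;
in the magic basis it is the transposition. Both partial traces of `C` vanish, so `C` is fixed by it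
(`spinFlip_eq_self_of_partialTraces_eq_zero`). If `C` commutes with `S = spinFlip U * U`, then
`U * C * Uᴴ` is fixed by it as well (`spinFlip_conj_eq_self`): in the magic basis this says that
`U C Uᴴ` is symmetric when the symmetric matrix `C` commutes with `Uᵀ U`. The system marginal of an
operator fixed by the spin flip is a scalar (`traceE_eq_smul_one_of_spinFlip_eq_self`), here of
trace zero, hence it vanishes.

It remains to make `C` commute with `S` by local unitaries. As `S` is unitary and fixed by the spin
flip, its Cayley transform (rotated to avoid the spectrum) is a Hermitian `M` fixed by the spin
flip, and what commutes with `M` commutes with `S` (`exists_hermitian_commutant_le`). Local unitaries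
form a compact set, so `Re tr (M C)` attains its maximum over the local orbit of `C`. At a maximum,
`tr (Z h) = 0` for `Z = C M - M C` and every local generator `h`. But `Z` is skew-Hermitian and
negated by the spin flip, so it is itself a local generator, and `Z = 0` (`commute_of_forall_re_trace_le`).
-/

/-! ### Partial traces -/

section PartialTrace

variable {s e : Type*}

/-- The partial trace over the system (the first tensor factor). -/
def traceS [Fintype s] (M : Matrix (s × e) (s × e) ℂ) : Matrix e e ℂ :=
  fun i j => ∑ k : s, M (k, i) (k, j)

theorem traceE_neg [Fintype e] (M : Matrix (s × e) (s × e) ℂ) : traceE (-M) = -traceE M := by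
  ext i j
  simp [traceE]

theorem traceS_neg [Fintype s] (M : Matrix (s × e) (s × e) ℂ) : traceS (-M) = -traceS M := by
  ext i j
  simp [traceS]

theorem traceE_sub [Fintype e] (M N : Matrix (s × e) (s × e) ℂ) :
    traceE (M - N) = traceE M - traceE N := by
  ext i j
  simp [traceE]

theorem traceS_sub [Fintype s] (M N : Matrix (s × e) (s × e) ℂ) :
    traceS (M - N) = traceS M - traceS N := by
  ext i j
  simp [traceS]

theorem trace_traceE [Fintype s] [Fintype e] (M : Matrix (s × e) (s × e) ℂ) :
    (traceE M).trace = M.trace := by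
  simp [Matrix.trace, traceE, Fintype.sum_prod_type]

theorem trace_traceS [Fintype s] [Fintype e] (M : Matrix (s × e) (s × e) ℂ) :
    (traceS M).trace = M.trace := by
  simp [Matrix.trace, traceS, Fintype.sum_prod_type_right]

theorem conjTranspose_traceE [Fintype e] (M : Matrix (s × e) (s × e) ℂ) :
    (traceE M)ᴴ = traceE Mᴴ := by
  ext i j
  simp [traceE]

theorem conjTranspose_traceS [Fintype s] (M : Matrix (s × e) (s × e) ℂ) :
    (traceS M)ᴴ = traceS Mᴴ := by
  ext i j
  simp [traceS]

theorem traceE_kronecker [Fintype e] (A : Matrix s s ℂ) (B : Matrix e e ℂ) :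
    traceE (A ⊗ₖ B) = B.trace • A := by
  ext i j
  simp [traceE, Matrix.trace, ← Finset.mul_sum, mul_comm]

theorem traceS_kronecker [Fintype s] (A : Matrix s s ℂ) (B : Matrix e e ℂ) :
    traceS (A ⊗ₖ B) = A.trace • B := by
  ext i j
  simp [traceS, Matrix.trace, ← Finset.sum_mul]

theorem posSemidef_traceS [Fintype s] {M : Matrix (s × e) (s × e) ℂ} (hM : M.PosSemidef) :
    (traceS M).PosSemidef := by
  have h : traceS M = ∑ k : s, M.submatrix (fun i => (k, i)) (fun i => (k, i)) := by
    ext i j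
    simp [traceS, Matrix.sum_apply]
  rw [h]
  exact Matrix.posSemidef_sum _ fun k _ => hM.submatrix _

variable [Fintype s] [Fintype e]

theorem applyLocal_smul (r : ℝ) (V : Matrix s s ℂ) (W : Matrix e e ℂ)
    (ρ : Matrix (s × e) (s × e) ℂ) :
    applyLocal ((r : ℂ) • V) W ρ = ((r * r : ℝ) : ℂ) • applyLocal V W ρ := by
  rw [applyLocal, Matrix.smul_kronecker, Matrix.conjTranspose_smul, smul_mul_assoc,
    smul_mul_smul_comm, Complex.star_def, Complex.conj_ofReal, Complex.ofReal_mul, applyLocal]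

theorem applyLocal_smul_right (r : ℝ) (V : Matrix s s ℂ) (W : Matrix e e ℂ)
    (ρ : Matrix (s × e) (s × e) ℂ) :
    applyLocal V ((r : ℂ) • W) ρ = ((r * r : ℝ) : ℂ) • applyLocal V W ρ := by
  rw [applyLocal, Matrix.kronecker_smul, Matrix.conjTranspose_smul, smul_mul_assoc,
    smul_mul_smul_comm, Complex.star_def, Complex.conj_ofReal, Complex.ofReal_mul, applyLocal]

theorem applyLocal_applyLocal (V V' : Matrix s s ℂ) (W W' : Matrix e e ℂ)
    (ρ : Matrix (s × e) (s × e) ℂ) :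
    applyLocal V W (applyLocal V' W' ρ) = applyLocal (V * V') (W * W') ρ := by
  simp only [applyLocal, Matrix.mul_kronecker_mul, Matrix.conjTranspose_mul, mul_assoc]

/-- The correlation part of a bipartite state: its difference from the product of its marginals. -/
def correlation (ρ : Matrix (s × e) (s × e) ℂ) : Matrix (s × e) (s × e) ℂ :=
  ρ - traceE ρ ⊗ₖ traceS ρ

theorem traceE_correlation {ρ : Matrix (s × e) (s × e) ℂ} (hρ : ρ.trace = 1) :
    traceE (correlation ρ) = 0 := by
  rw [correlation, traceE_sub, traceE_kronecker, trace_traceS, hρ, one_smul, sub_self]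

theorem traceS_correlation {ρ : Matrix (s × e) (s × e) ℂ} (hρ : ρ.trace = 1) :
    traceS (correlation ρ) = 0 := by
  rw [correlation, traceS_sub, traceS_kronecker, trace_traceE, hρ, one_smul, sub_self]

theorem conjTranspose_correlation {ρ : Matrix (s × e) (s × e) ℂ} (hρ : ρᴴ = ρ) :
    (correlation ρ)ᴴ = correlation ρ := by
  rw [correlation, Matrix.conjTranspose_sub, Matrix.conjTranspose_kronecker,
    conjTranspose_traceE, conjTranspose_traceS, hρ]

/-- The partial trace over the environment is dual to `A ↦ A ⊗ 1`. -/
theorem trace_kronecker_one_mul [DecidableEq e] (A : Matrix s s ℂ)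
    (M : Matrix (s × e) (s × e) ℂ) :
    ((A ⊗ₖ (1 : Matrix e e ℂ)) * M).trace = (A * traceE M).trace := by
  simp only [Matrix.trace, Matrix.diag_apply, Matrix.mul_apply, Fintype.sum_prod_type,
    Matrix.kroneckerMap_apply, Matrix.one_apply, mul_ite, mul_one, mul_zero, ite_mul, zero_mul,
    Finset.sum_ite_eq, Finset.mem_univ, if_true, traceE, Finset.mul_sum]
  exact Finset.sum_congr rfl fun i _ => Finset.sum_comm

/-- The partial trace over the system is dual to `B ↦ 1 ⊗ B`. -/
theorem trace_one_kronecker_mul [DecidableEq s] (B : Matrix e e ℂ)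
    (M : Matrix (s × e) (s × e) ℂ) :
    (((1 : Matrix s s ℂ) ⊗ₖ B) * M).trace = (B * traceS M).trace := by
  simp only [Matrix.trace, Matrix.diag_apply, Matrix.mul_apply, Fintype.sum_prod_type,
    Matrix.kroneckerMap_apply, Matrix.one_apply, ite_mul, one_mul, zero_mul,
    traceS, Finset.mul_sum]
  rw [Finset.sum_comm]
  refine Finset.sum_congr rfl fun i _ => ?_
  rw [Finset.sum_comm' (t' := Finset.univ) (s' := fun _ => Finset.univ) (by simp)]
  simp only [Finset.sum_ite_irrel, Finset.sum_const_zero]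
  rw [Finset.sum_comm]
  simp only [Finset.sum_ite_eq, Finset.mem_univ, if_true]
  exact Finset.sum_comm

theorem traceE_applyLocal [DecidableEq e] (V : Matrix s s ℂ) {W : Matrix e e ℂ}
    (hW : W ∈ Matrix.unitaryGroup e ℂ) (ρ : Matrix (s × e) (s × e) ℂ) :
    traceE (applyLocal V W ρ) = V * traceE ρ * Vᴴ := by
  have hW' : Wᴴ * W = 1 := Matrix.mem_unitaryGroup_iff'.mp hW
  refine Matrix.ext_iff_trace_mul_left.mpr fun A => ?_
  rw [← trace_kronecker_one_mul, applyLocal, Matrix.conjTranspose_kronecker, ← mul_assoc,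
    Matrix.trace_mul_comm, ← mul_assoc, ← mul_assoc, ← Matrix.mul_kronecker_mul,
    ← Matrix.mul_kronecker_mul, mul_one, hW', trace_kronecker_one_mul, ← mul_assoc,
    Matrix.trace_mul_comm (A * _)]
  simp only [mul_assoc]

theorem traceS_applyLocal [DecidableEq s] {V : Matrix s s ℂ} (hV : V ∈ Matrix.unitaryGroup s ℂ)
    (W : Matrix e e ℂ) (ρ : Matrix (s × e) (s × e) ℂ) :
    traceS (applyLocal V W ρ) = W * traceS ρ * Wᴴ := by
  have hV' : Vᴴ * V = 1 := Matrix.mem_unitaryGroup_iff'.mp hV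
  refine Matrix.ext_iff_trace_mul_left.mpr fun A => ?_
  rw [← trace_one_kronecker_mul, applyLocal, Matrix.conjTranspose_kronecker, ← mul_assoc,
    Matrix.trace_mul_comm, ← mul_assoc, ← mul_assoc, ← Matrix.mul_kronecker_mul,
    ← Matrix.mul_kronecker_mul, mul_one, hV', trace_one_kronecker_mul, ← mul_assoc,
    Matrix.trace_mul_comm (A * _)]
  simp only [mul_assoc]

variable [DecidableEq s] [DecidableEq e]

theorem IsDensity.applyLocal {ρ : Matrix (s × e) (s × e) ℂ} (hρ : IsDensity ρ)
    {V : Matrix s s ℂ} {W : Matrix e e ℂ} (hV : V ∈ Matrix.unitaryGroup s ℂ)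
    (hW : W ∈ Matrix.unitaryGroup e ℂ) : IsDensity (applyLocal V W ρ) := by
  refine ⟨hρ.1.mul_mul_conjTranspose_same _, ?_⟩
  have h : (V ⊗ₖ W)ᴴ * (V ⊗ₖ W) = 1 :=
    Matrix.mem_unitaryGroup_iff'.mp (Matrix.kronecker_mem_unitary hV hW)
  rw [_root_.applyLocal, Matrix.trace_mul_comm, ← mul_assoc, h, one_mul, hρ.2]

theorem correlation_applyLocal {V : Matrix s s ℂ} {W : Matrix e e ℂ}
    (hV : V ∈ Matrix.unitaryGroup s ℂ) (hW : W ∈ Matrix.unitaryGroup e ℂ)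
    (ρ : Matrix (s × e) (s × e) ℂ) :
    correlation (applyLocal V W ρ) = applyLocal V W (correlation ρ) := by
  rw [correlation, traceE_applyLocal V hW, traceS_applyLocal hV W, Matrix.mul_kronecker_mul,
    Matrix.mul_kronecker_mul, ← Matrix.conjTranspose_kronecker]
  simp only [correlation, applyLocal, mul_sub, sub_mul]

end PartialTrace

/-! ### The spin flip of two qubits -/

/-- The real antisymmetric matrix `i σ_y`. -/
def symplecticTwo : Matrix (Fin 2) (Fin 2) ℂ := !![0, 1; -1, 0]

/-- The spin flip `X ↦ J Xᵀ J` of two-qubit operators, with `J = σ_y ⊗ σ_y` up to sign. It is a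
linear anti-automorphism which fixes `1` and every `σ_i ⊗ σ_j`, and negates `σ_i ⊗ 1` and
`1 ⊗ σ_j`. In the magic basis it is the transposition. -/
def spinFlip (X : Matrix (Fin 2 × Fin 2) (Fin 2 × Fin 2) ℂ) :
    Matrix (Fin 2 × Fin 2) (Fin 2 × Fin 2) ℂ :=
  (symplecticTwo ⊗ₖ symplecticTwo) * Xᵀ * (symplecticTwo ⊗ₖ symplecticTwo)

theorem symplecticTwo_mul_self : symplecticTwo * symplecticTwo = -1 := by
  ext i j
  fin_cases i <;> fin_cases j <;> simp [symplecticTwo]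

theorem symplecticTwo_kronecker_mul_self :
    (symplecticTwo ⊗ₖ symplecticTwo) * (symplecticTwo ⊗ₖ symplecticTwo) = 1 := by
  rw [← Matrix.mul_kronecker_mul, symplecticTwo_mul_self]
  ext ⟨i, j⟩ ⟨k, l⟩
  fin_cases i <;> fin_cases j <;> fin_cases k <;> fin_cases l <;> simp

theorem symplecticTwo_kronecker_transpose :
    (symplecticTwo ⊗ₖ symplecticTwo)ᵀ = symplecticTwo ⊗ₖ symplecticTwo := by
  ext ⟨i, j⟩ ⟨k, l⟩
  fin_cases i <;> fin_cases j <;> fin_cases k <;> fin_cases l <;> simp [symplecticTwo]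

theorem symplecticTwo_kronecker_conjTranspose :
    (symplecticTwo ⊗ₖ symplecticTwo)ᴴ = symplecticTwo ⊗ₖ symplecticTwo := by
  ext ⟨i, j⟩ ⟨k, l⟩
  fin_cases i <;> fin_cases j <;> fin_cases k <;> fin_cases l <;> simp [symplecticTwo]

section SpinFlip

variable (X Y : Matrix (Fin 2 × Fin 2) (Fin 2 × Fin 2) ℂ)

theorem spinFlip_one : spinFlip 1 = 1 := by
  rw [spinFlip, Matrix.transpose_one, mul_one, symplecticTwo_kronecker_mul_self]

theorem spinFlip_sub : spinFlip (X - Y) = spinFlip X - spinFlip Y := by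
  simp [spinFlip, mul_sub, sub_mul]

theorem spinFlip_smul (c : ℂ) : spinFlip (c • X) = c • spinFlip X := by
  simp [spinFlip]

theorem spinFlip_mul : spinFlip (X * Y) = spinFlip Y * spinFlip X := by
  have h : spinFlip Y * spinFlip X = (symplecticTwo ⊗ₖ symplecticTwo) * Yᵀ *
      ((symplecticTwo ⊗ₖ symplecticTwo) * (symplecticTwo ⊗ₖ symplecticTwo)) * Xᵀ *
      (symplecticTwo ⊗ₖ symplecticTwo) := by
    simp only [spinFlip, mul_assoc]
  rw [h, symplecticTwo_kronecker_mul_self, spinFlip, Matrix.transpose_mul]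
  simp only [mul_assoc, mul_one]

theorem spinFlip_spinFlip : spinFlip (spinFlip X) = X := by
  have h : spinFlip (spinFlip X) =
      ((symplecticTwo ⊗ₖ symplecticTwo) * (symplecticTwo ⊗ₖ symplecticTwo)) * X *
      ((symplecticTwo ⊗ₖ symplecticTwo) * (symplecticTwo ⊗ₖ symplecticTwo)) := by
    simp only [spinFlip, Matrix.transpose_mul, symplecticTwo_kronecker_transpose,
      Matrix.transpose_transpose, mul_assoc]
  rw [h, symplecticTwo_kronecker_mul_self, one_mul, mul_one]

theorem spinFlip_conjTranspose : spinFlip Xᴴ = (spinFlip X)ᴴ := by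
  simp only [spinFlip, Matrix.conjTranspose_mul, symplecticTwo_kronecker_conjTranspose, mul_assoc]
  rfl

theorem trace_spinFlip : (spinFlip X).trace = X.trace := by
  rw [spinFlip, Matrix.trace_mul_comm, ← mul_assoc, symplecticTwo_kronecker_mul_self, one_mul,
    Matrix.trace_transpose]

variable {X}

theorem spinFlip_eq_self_of_partialTraces_eq_zero (hE : traceE X = 0) (hS : traceS X = 0) :
    spinFlip X = X := by
  have e := fun i j => congrFun (congrFun hE i) j
  have s := fun i j => congrFun (congrFun hS i) j
  simp only [traceE, traceS, Fin.sum_univ_two, Matrix.zero_apply, Fin.forall_fin_two] at e s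
  obtain ⟨⟨e1, e2⟩, e3, e4⟩ := e
  obtain ⟨⟨s1, s2⟩, s3, s4⟩ := s
  ext ⟨i, j⟩ ⟨k, l⟩
  fin_cases i <;> fin_cases j <;> fin_cases k <;> fin_cases l <;>
    simp [spinFlip, symplecticTwo, Matrix.mul_apply, Fintype.sum_prod_type] <;> grind

theorem traceE_eq_smul_one_of_spinFlip_eq_self (h : spinFlip X = X) :
    traceE X = (X.trace / 2) • 1 := by
  have e := fun p q => congrFun (congrFun h p) q
  simp [spinFlip, symplecticTwo, Matrix.mul_apply, Fintype.sum_prod_type, Prod.forall,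
    Fin.forall_fin_two] at e
  ext i j
  fin_cases i <;> fin_cases j <;>
    simp [traceE, Matrix.trace, Fintype.sum_prod_type, Matrix.smul_apply] <;> grind

theorem trace_eq_zero_of_spinFlip_eq_neg (h : spinFlip X = -X) : X.trace = 0 := by
  have h1 := trace_spinFlip X
  rw [h, Matrix.trace_neg] at h1
  exact self_eq_neg.mp h1.symm

/-- A spin-flip-odd operator lies in the span of the `σ_i ⊗ 1` and `1 ⊗ σ_j`, so it is determined
by its partial traces. -/
theorem eq_zero_of_spinFlip_eq_neg (h : spinFlip X = -X) (hE : traceE X = 0)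
    (hS : traceS X = 0) : X = 0 := by
  have h1 := (spinFlip_eq_self_of_partialTraces_eq_zero hE hS).symm.trans h
  ext p q
  exact self_eq_neg.mp (congrFun (congrFun h1 p) q)

end SpinFlip

/-! ### The Cayley transform of a unitary matrix -/

section Cayley

variable {n : Type*} [Fintype n] [DecidableEq n]

theorem exists_norm_one_isUnit_smul_one_sub (S : Matrix n n ℂ) :
    ∃ μ : ℂ, ‖μ‖ = 1 ∧ IsUnit (μ • (1 : Matrix n n ℂ) - S).det := by
  have hinf : Infinite Circle := by
    have : Infinite (Set.Ioc (-Real.pi) Real.pi) :=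
      Set.infinite_coe_iff.mpr (Set.Ioc_infinite (by linarith [Real.pi_pos]))
    exact Infinite.of_injective _ Circle.argEquiv.symm.injective
  obtain ⟨z, hz⟩ := (S.charpoly.roots.toFinset.finite_toSet.preimage
    (f := fun z : Circle => (z : ℂ)) Circle.coe_injective.injOn).infinite_compl.nonempty
  refine ⟨z, z.norm_coe, ?_⟩
  have hz' : ¬ S.charpoly.IsRoot z := by
    simpa [S.charpoly_monic.ne_zero] using hz
  rw [Polynomial.IsRoot, Matrix.eval_charpoly] at hz'
  rw [isUnit_iff_ne_zero, Matrix.smul_one_eq_diagonal]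
  exact hz'

/-- For a unitary `S` and a unit complex number `μ` outside its spectrum, the Cayley transform
`i (2 μ (μ - S)⁻¹ - 1)` of `S` is Hermitian. -/
theorem conjTranspose_cayley {S : Matrix n n ℂ} (hS : S * Sᴴ = 1) {μ : ℂ} (hμ : ‖μ‖ = 1)
    (hu : IsUnit (μ • (1 : Matrix n n ℂ) - S).det) :
    (Complex.I • ((2 * μ) • (μ • (1 : Matrix n n ℂ) - S)⁻¹ - 1))ᴴ =
      Complex.I • ((2 * μ) • (μ • (1 : Matrix n n ℂ) - S)⁻¹ - 1) := by
  set P := μ • (1 : Matrix n n ℂ) - S with hP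
  have hμ' : μ * star μ = 1 := by
    have := Complex.mul_conj' μ
    simpa [hμ] using this
  have hPH : Pᴴ = star μ • 1 - Sᴴ := by
    simp [hP]
  have h1 : P * (star μ • Sᴴ) = -Pᴴ := by
    rw [hPH, hP, sub_mul, mul_smul_comm, mul_smul_comm, hS, smul_mul_assoc, one_mul, smul_smul,
      mul_comm, hμ', one_smul, neg_sub]
  -- The Hermitian part of `μ P⁻¹` is `1 / 2`, because `(1 - μ P⁻¹) Pᴴ = μ̄`.
  have h2 : star μ • P⁻¹ᴴ = 1 - μ • P⁻¹ := by
    have huH : IsUnit Pᴴ.det := by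
      rw [Matrix.det_conjTranspose]
      exact hu.star
    have h3 : (1 - μ • P⁻¹) * Pᴴ = star μ • 1 := by
      have h4 : P⁻¹ * Pᴴ = -(star μ • Sᴴ) := by
        rw [← neg_eq_iff_eq_neg, ← mul_neg, ← h1, ← mul_assoc, Matrix.nonsing_inv_mul _ hu,
          one_mul]
      rw [sub_mul, smul_mul_assoc, h4, one_mul, smul_neg, smul_smul, hμ', one_smul, hPH]
      abel
    rw [Matrix.conjTranspose_nonsing_inv]
    calc star μ • Pᴴ⁻¹ = (star μ • 1) * Pᴴ⁻¹ := by rw [smul_mul_assoc, one_mul]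
      _ = _ := by rw [← h3, mul_assoc, Matrix.mul_nonsing_inv _ huH, mul_one]
  have h5 : star (2 * μ) • P⁻¹ᴴ = (2 : ℂ) • (1 - μ • P⁻¹) := by
    rw [← h2, smul_smul, star_mul', star_ofNat]
  rw [Matrix.conjTranspose_smul, Matrix.conjTranspose_sub, Matrix.conjTranspose_smul,
    Matrix.conjTranspose_one, h5, Complex.star_def, Complex.conj_I]
  module

end Cayley

/-! ### Maximization over local unitaries -/

theorem isCompact_unitaryGroup (n : Type*) [Fintype n] [DecidableEq n] :
    IsCompact (Matrix.unitaryGroup n ℂ : Set (Matrix n n ℂ)) := by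
  have hK : IsCompact (Set.univ.pi fun _ : n => Set.univ.pi fun _ : n =>
      Metric.closedBall (0 : ℂ) 1) :=
    isCompact_univ_pi fun _ => isCompact_univ_pi fun _ => isCompact_closedBall _ _
  refine hK.of_isClosed_subset ?_ ?_
  · have : (Matrix.unitaryGroup n ℂ : Set (Matrix n n ℂ)) = {A | A * Aᴴ = 1} := by
      ext A
      exact Matrix.mem_unitaryGroup_iff
    rw [this]
    exact isClosed_eq (by fun_prop) continuous_const
  · intro A hA i _ j _
    simpa using entry_norm_bound_of_unitary hA i j

theorem eq_zero_of_forall_mul_le_sq_mul {q k : ℝ} (h : ∀ t : ℝ, t * q ≤ t ^ 2 * k) : q = 0 := by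
  by_contra hq
  have hK : 0 < |k| + 1 := by positivity
  have h1 := h (q / (|k| + 1))
  have h2 : q / (|k| + 1) * q = (q / (|k| + 1)) ^ 2 * (|k| + 1) := by
    field_simp
  have h3 : 0 < (q / (|k| + 1)) ^ 2 := by positivity
  rw [h2] at h1
  have := le_of_mul_le_mul_left h1 h3
  linarith [le_abs_self k]

/-- The first-order condition at a maximum: `(1 + t h) / √(1 + t² c)` plays the part of `exp (t h)`
for a skew-Hermitian `h` with `h² = -c`. -/
theorem re_trace_mul_commutator_eq_zero {n : Type*} [Fintype n] [DecidableEq n]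
    {M C h : Matrix n n ℂ} {c : ℝ} (hskew : hᴴ = -h)
    (hmax : ∀ t : ℝ, (M * ((1 + (t : ℂ) • h) * C * (1 + (t : ℂ) • h)ᴴ)).trace.re ≤
      (1 + t ^ 2 * c) * (M * C).trace.re) :
    (h * (C * M - M * C)).trace.re = 0 := by
  -- Both sides of `hmax` are quadratic in `t` with equal values at `0`, so the linear term vanishes.
  refine eq_zero_of_forall_mul_le_sq_mul
    (k := c * (M * C).trace.re + (M * (h * C * h)).trace.re) fun t => ?_
  have h1 : M * ((1 + (t : ℂ) • h) * C * (1 + (t : ℂ) • h)ᴴ) =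
      M * C + (t : ℂ) • (M * h * C - M * C * h) - ((t ^ 2 : ℝ) : ℂ) • (M * (h * C * h)) := by
    have h2 : (1 + (t : ℂ) • h)ᴴ = 1 - (t : ℂ) • h := by
      simp [hskew, sub_eq_add_neg]
    rw [h2]
    simp only [add_mul, mul_add, mul_sub, one_mul, mul_one, smul_mul_assoc, mul_smul_comm,
      smul_sub, mul_assoc, pow_two]
    module
  have h3 : (M * h * C - M * C * h).trace = (h * (C * M - M * C)).trace := by
    rw [mul_sub, Matrix.trace_sub, Matrix.trace_sub, mul_assoc M, Matrix.trace_mul_comm M,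
      Matrix.trace_mul_comm (M * C), mul_assoc]
  have h4 := hmax t
  rw [h1, Matrix.trace_sub, Matrix.trace_add, Matrix.trace_smul, Matrix.trace_smul, h3,
    smul_eq_mul, smul_eq_mul, Complex.sub_re, Complex.add_re, Complex.re_ofReal_mul,
    Complex.re_ofReal_mul] at h4
  linarith

theorem exists_mul_self_eq_neg_smul_one {A : Matrix (Fin 2) (Fin 2) ℂ} (hA : Aᴴ = -A)
    (htr : A.trace = 0) : ∃ c : ℝ, 0 ≤ c ∧ A * A = -((c : ℂ) • 1) := by
  refine ⟨Complex.normSq (A 0 0) + Complex.normSq (A 0 1),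
    add_nonneg (Complex.normSq_nonneg _) (Complex.normSq_nonneg _), ?_⟩
  have e := fun i j => congrFun (congrFun hA i) j
  simp only [Matrix.conjTranspose_apply, Matrix.neg_apply, Fin.forall_fin_two] at e
  obtain ⟨⟨e1, e2⟩, e3, e4⟩ := e
  rw [Matrix.trace_fin_two] at htr
  simp only [Complex.ofReal_add, ← Complex.mul_conj, ← Complex.star_def]
  ext i j
  fin_cases i <;> fin_cases j <;>
    simp only [Matrix.mul_apply, Fin.sum_univ_two, Matrix.neg_apply, Matrix.smul_apply,
      Matrix.one_apply, smul_eq_mul, Fin.zero_eta, Fin.mk_one, Fin.isValue, if_true,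
      zero_ne_one, one_ne_zero, if_false] <;> grind

theorem smul_one_add_smul_mem_unitaryGroup {A : Matrix (Fin 2) (Fin 2) ℂ} {c : ℝ} (hA : Aᴴ = -A)
    (hc : 0 ≤ c) (hsq : A * A = -((c : ℂ) • 1)) (t : ℝ) :
    (((√(1 + t ^ 2 * c))⁻¹ : ℝ) : ℂ) • (1 + (t : ℂ) • A) ∈ Matrix.unitaryGroup (Fin 2) ℂ := by
  have hpos : 0 < 1 + t ^ 2 * c := by positivity
  have h2 : (1 + (t : ℂ) • A)ᴴ = 1 - (t : ℂ) • A := by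
    simp [hA, sub_eq_add_neg]
  have h3 : (1 + (t : ℂ) • A) * (1 - (t : ℂ) • A) = ((1 + t ^ 2 * c : ℝ) : ℂ) • 1 := by
    simp only [add_mul, mul_sub, one_mul, mul_one, smul_mul_assoc, mul_smul_comm, hsq]
    push_cast
    module
  rw [Matrix.mem_unitaryGroup_iff, Matrix.star_eq_conjTranspose, Matrix.conjTranspose_smul, h2,
    smul_mul_smul_comm, h3, smul_smul, Complex.star_def, Complex.conj_ofReal,
    ← Complex.ofReal_mul, ← Complex.ofReal_mul, ← mul_inv, Real.mul_self_sqrt hpos.le,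
    inv_mul_cancel₀ hpos.ne', Complex.ofReal_one, one_smul]

section LocalMaximum

variable {M C : Matrix (Fin 2 × Fin 2) (Fin 2 × Fin 2) ℂ}

theorem eq_zero_of_skew_of_re_trace_mul_self {A : Matrix (Fin 2) (Fin 2) ℂ} (hA : Aᴴ = -A)
    {c : ℝ} (hsq : A * A = -((c : ℂ) • 1)) (h : (A * A).trace.re = 0) : A = 0 := by
  rw [hsq] at h
  have hc : c = 0 := by
    simpa [Matrix.trace_neg, Matrix.trace_smul] using h
  rw [← Matrix.conjTranspose_mul_self_eq_zero, hA, neg_mul, hsq, hc]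
  simp

/-- At a maximum of `Re tr (M (V ⊗ W) C (V ⊗ W)ᴴ)` over the local unitaries, attained at `1 ⊗ 1`,
spin-flip-even Hermitian operators `M` and `C` commute: their commutator is skew-Hermitian and
spin-flip-odd, hence a local generator, and the first-order condition says that it is orthogonal
to all of these. -/
theorem commute_of_forall_re_trace_le (hM : Mᴴ = M) (hC : Cᴴ = C) (fM : spinFlip M = M)
    (fC : spinFlip C = C)
    (hmax : ∀ V ∈ Matrix.unitaryGroup (Fin 2) ℂ, ∀ W ∈ Matrix.unitaryGroup (Fin 2) ℂ,
      (M * applyLocal V W C).trace.re ≤ (M * C).trace.re) :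
    C * M = M * C := by
  set Z := C * M - M * C with hZ
  have zskew : Zᴴ = -Z := by
    simp [hZ, Matrix.conjTranspose_sub, Matrix.conjTranspose_mul, hM, hC]
  have zflip : spinFlip Z = -Z := by
    rw [hZ, spinFlip_sub, spinFlip_mul, spinFlip_mul, fM, fC, neg_sub]
  have ztr : Z.trace = 0 := trace_eq_zero_of_spinFlip_eq_neg zflip
  have hE : traceE Z = 0 := by
    have hA : (traceE Z)ᴴ = -traceE Z := by
      rw [conjTranspose_traceE, zskew, traceE_neg]
    obtain ⟨c, hc, hsq⟩ := exists_mul_self_eq_neg_smul_one hA ((trace_traceE Z).trans ztr)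
    refine eq_zero_of_skew_of_re_trace_mul_self hA hsq ?_
    rw [← trace_kronecker_one_mul]
    refine re_trace_mul_commutator_eq_zero (c := c) ?_ fun t => ?_
    · rw [Matrix.conjTranspose_kronecker, hA, Matrix.conjTranspose_one]
      ext
      simp
    · have hpos : 0 < 1 + t ^ 2 * c := by positivity
      have h := hmax _ (smul_one_add_smul_mem_unitaryGroup hA hc hsq t) 1 (one_mem _)
      rw [applyLocal_smul, mul_smul_comm, Matrix.trace_smul, smul_eq_mul, Complex.re_ofReal_mul,
        ← mul_inv, Real.mul_self_sqrt hpos.le, inv_mul_le_iff₀ hpos] at h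
      rwa [applyLocal, Matrix.add_kronecker, Matrix.one_kronecker_one, Matrix.smul_kronecker] at h
  have hS : traceS Z = 0 := by
    have hA : (traceS Z)ᴴ = -traceS Z := by
      rw [conjTranspose_traceS, zskew, traceS_neg]
    obtain ⟨c, hc, hsq⟩ := exists_mul_self_eq_neg_smul_one hA ((trace_traceS Z).trans ztr)
    refine eq_zero_of_skew_of_re_trace_mul_self hA hsq ?_
    rw [← trace_one_kronecker_mul]
    refine re_trace_mul_commutator_eq_zero (c := c) ?_ fun t => ?_
    · rw [Matrix.conjTranspose_kronecker, hA, Matrix.conjTranspose_one]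
      ext
      simp
    · have hpos : 0 < 1 + t ^ 2 * c := by positivity
      have h := hmax 1 (one_mem _) _ (smul_one_add_smul_mem_unitaryGroup hA hc hsq t)
      rw [applyLocal_smul_right, mul_smul_comm, Matrix.trace_smul, smul_eq_mul,
        Complex.re_ofReal_mul, ← mul_inv, Real.mul_self_sqrt hpos.le, inv_mul_le_iff₀ hpos] at h
      rwa [applyLocal, Matrix.kronecker_add, Matrix.one_kronecker_one, Matrix.kronecker_smul] at h
  exact sub_eq_zero.mp (eq_zero_of_spinFlip_eq_neg zflip hE hS)

end LocalMaximum

theorem exists_forall_re_trace_applyLocal_le {s e : Type*} [Fintype s] [Fintype e]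
    [DecidableEq s] [DecidableEq e] (M C : Matrix (s × e) (s × e) ℂ) :
    ∃ V ∈ Matrix.unitaryGroup s ℂ, ∃ W ∈ Matrix.unitaryGroup e ℂ,
      ∀ V' ∈ Matrix.unitaryGroup s ℂ, ∀ W' ∈ Matrix.unitaryGroup e ℂ,
        (M * applyLocal V' W' C).trace.re ≤ (M * applyLocal V W C).trace.re := by
  have hk : Continuous fun p : Matrix s s ℂ × Matrix e e ℂ => p.1 ⊗ₖ p.2 :=
    continuous_matrix fun i j => by
      simp only [Matrix.kroneckerMap_apply]
      fun_prop
  have hf : Continuous fun p : Matrix s s ℂ × Matrix e e ℂ =>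
      (M * applyLocal p.1 p.2 C).trace.re :=
    Complex.continuous_re.comp (Continuous.matrix_trace (continuous_const.matrix_mul
      ((hk.matrix_mul continuous_const).matrix_mul hk.matrix_conjTranspose)))
  have hne : ((Matrix.unitaryGroup s ℂ : Set (Matrix s s ℂ)) ×ˢ
      (Matrix.unitaryGroup e ℂ : Set (Matrix e e ℂ))).Nonempty :=
    Set.Nonempty.prod ⟨1, one_mem _⟩ ⟨1, one_mem _⟩
  obtain ⟨⟨V, W⟩, ⟨hV, hW⟩, hmax⟩ :=
    ((isCompact_unitaryGroup s).prod (isCompact_unitaryGroup e)).exists_isMaxOn hne hf.continuousOn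
  refine ⟨V, hV, W, hW, fun V' hV' W' hW' => ?_⟩
  exact isMaxOn_iff.mp hmax (V', W') ⟨hV', hW'⟩

/-! ### Generating the dynamics from a product state -/

section Dynamics

variable {U C : Matrix (Fin 2 × Fin 2) (Fin 2 × Fin 2) ℂ}

/-- If a spin-flip-even `C` commutes with `spinFlip U * U`, then `U C Uᴴ` is spin-flip-even. In the
magic basis: `U C Uᴴ` is symmetric when the symmetric matrix `C` commutes with `Uᵀ U`. -/
theorem spinFlip_conj_eq_self (hU : U * Uᴴ = 1) (fC : spinFlip C = C)
    (h : spinFlip U * U * C = C * (spinFlip U * U)) :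
    spinFlip (U * C * Uᴴ) = U * C * Uᴴ := by
  have h1 : spinFlip Uᴴ * spinFlip U = 1 := by
    rw [← spinFlip_mul, hU, spinFlip_one]
  calc spinFlip (U * C * Uᴴ) = spinFlip Uᴴ * (C * (spinFlip U * U)) * Uᴴ := by
        rw [spinFlip_mul, spinFlip_mul, fC]
        simp only [mul_assoc, hU, mul_one]
    _ = (spinFlip Uᴴ * spinFlip U) * (U * C * Uᴴ) := by
        rw [← h]
        simp only [mul_assoc]
    _ = U * C * Uᴴ := by rw [h1, one_mul]

/-- A spin-flip-even Hermitian operator whose commutant lies in that of the given spin-flip-even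
unitary, found by the Cayley transform. -/
theorem exists_hermitian_commutant_le {S : Matrix (Fin 2 × Fin 2) (Fin 2 × Fin 2) ℂ}
    (hS : S * Sᴴ = 1) (fS : spinFlip S = S) :
    ∃ M : Matrix (Fin 2 × Fin 2) (Fin 2 × Fin 2) ℂ, Mᴴ = M ∧ spinFlip M = M ∧
      ∀ C, C * M = M * C → S * C = C * S := by
  obtain ⟨μ, hμ, hu⟩ := exists_norm_one_isUnit_smul_one_sub S
  refine ⟨_, conjTranspose_cayley hS hμ hu, ?_, fun C hC => ?_⟩
  · have fP : spinFlip (μ • 1 - S) = μ • 1 - S := by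
      rw [spinFlip_sub, spinFlip_smul, spinFlip_one, fS]
    have fQ : spinFlip (μ • 1 - S)⁻¹ = (μ • 1 - S)⁻¹ := by
      refine (Matrix.inv_eq_right_inv ?_).symm
      nth_rewrite 1 [← fP]
      rw [← spinFlip_mul, Matrix.nonsing_inv_mul _ hu, spinFlip_one]
    rw [spinFlip_smul, spinFlip_sub, spinFlip_smul, spinFlip_one, fQ]
  · have hμ0 : 2 * μ ≠ 0 := mul_ne_zero two_ne_zero (norm_ne_zero_iff.mp (hμ ▸ one_ne_zero))
    have hQ : C * (μ • 1 - S)⁻¹ = (μ • 1 - S)⁻¹ * C := by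
      simp only [mul_smul_comm, smul_mul_assoc, mul_sub, sub_mul, mul_one, one_mul] at hC
      have h1 := smul_right_injective _ Complex.I_ne_zero hC
      exact smul_right_injective _ hμ0 (sub_left_injective h1)
    have hP : (μ • 1 - S) * C = C * (μ • 1 - S) := by
      calc (μ • 1 - S) * C = (μ • 1 - S) * (C * (μ • 1 - S)⁻¹) * (μ • 1 - S) := by
            rw [mul_assoc, mul_assoc, Matrix.nonsing_inv_mul _ hu, mul_one]
        _ = C * (μ • 1 - S) := by
            rw [hQ, ← mul_assoc (μ • 1 - S), Matrix.mul_nonsing_inv _ hu, one_mul]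
    simpa [sub_mul, mul_sub] using hP

end Dynamics

theorem corollary1
    (U : Matrix (Fin 2 × Fin 2) (Fin 2 × Fin 2) ℂ)
    (hU : U ∈ Matrix.unitaryGroup (Fin 2 × Fin 2) ℂ)
    (ρ : Matrix (Fin 2 × Fin 2) (Fin 2 × Fin 2) ℂ) (hρ : IsDensity ρ) :
    ∃ V ∈ Matrix.unitaryGroup (Fin 2) ℂ, ∃ W ∈ Matrix.unitaryGroup (Fin 2) ℂ,
      CanBeUGeneratedByProduct U (applyLocal V W ρ) := by
  have hU1 : U * Uᴴ = 1 := Matrix.mem_unitaryGroup_iff.mp hU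
  have hU2 : Uᴴ * U = 1 := Matrix.mem_unitaryGroup_iff'.mp hU
  have hS : spinFlip U * U * (spinFlip U * U)ᴴ = 1 := by
    rw [Matrix.conjTranspose_mul, mul_assoc, ← mul_assoc U, hU1, one_mul,
      ← spinFlip_conjTranspose, ← spinFlip_mul, hU2, spinFlip_one]
  have fS : spinFlip (spinFlip U * U) = spinFlip U * U := by
    rw [spinFlip_mul, spinFlip_spinFlip]
  obtain ⟨M, hM, fM, hcomm⟩ := exists_hermitian_commutant_le hS fS
  obtain ⟨V, hV, W, hW, hmax⟩ := exists_forall_re_trace_applyLocal_le M (correlation ρ)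
  have hρ' : IsDensity (applyLocal V W ρ) := hρ.applyLocal hV hW
  refine ⟨V, hV, W, hW, traceS (applyLocal V W ρ),
    ⟨posSemidef_traceS hρ'.1, (trace_traceS _).trans hρ'.2⟩, ?_⟩
  rw [← correlation_applyLocal hV hW] at hmax
  have fC := spinFlip_eq_self_of_partialTraces_eq_zero (traceE_correlation hρ'.2)
    (traceS_correlation hρ'.2)
  have hC : correlation (applyLocal V W ρ) * M = M * correlation (applyLocal V W ρ) := by
    refine commute_of_forall_re_trace_le hM (conjTranspose_correlation hρ'.1.1) fM fC
      fun V' hV' W' hW' => ?_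
    rw [correlation_applyLocal hV hW ρ, applyLocal_applyLocal, ← correlation_applyLocal hV hW]
    exact hmax _ (mul_mem hV' hV) _ (mul_mem hW' hW)
  have htr : (U * correlation (applyLocal V W ρ) * Uᴴ).trace = 0 := by
    rw [Matrix.trace_mul_comm, ← mul_assoc, hU2, one_mul, ← trace_traceE,
      traceE_correlation hρ'.2, Matrix.trace_zero]
  have h0 := traceE_eq_smul_one_of_spinFlip_eq_self
    (spinFlip_conj_eq_self hU1 fC (hcomm _ hC))
  rw [htr, zero_div, zero_smul, correlation, mul_sub, sub_mul, traceE_sub] at h0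
  exact sub_eq_zero.mp h0
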